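/- Let $\mathbb D$ be the open unit disc, $H^2$ the Hardy space on $\mathbb D$, $H^\infty$ the Banach algebra of bounded analytic functions on $\mathbb D$ with the uniform norm $\|\cdot\|_\infty$, and $S$ the unilateral shift, i.e. the operator of multiplication by the independent variable on $H^2$. For a bounded operator $T$ on a complex Hilbert space $\mathcal H$: (i) $T$ is polynomially bounded if there is a constant $C$ with $\|p(T)\|\le C\sup_{z\in\mathbb D}|p(z)|$ for every complex polynomial $p$; (ii) $\operatorname{Lat}T$ is the set of closed linear subspaces $\mathcal M\subset\mathcal H$ with $T\mathcal M\subset\mathcal M$; (iii) the multiplicity $\mu_T\in\{1,2,\dots,\infty\}$ is the least number $m\ge 1$ of vectors $x_1,\dots,x_m\in\mathcal H$ such that the closed linear span of $\{T^jx_k: 1\le k\le m,\ j\ge 0\}$ is $\mathcal H$ (and $\mu_T=\infty$ if there is no such finite $m$); (iv) $T$ is absolutely continuous if the $H^\infty$-functional calculus is well defined for $T$, i.e. there is a bounded unital algebra homomorphism $\Phi:H^\infty\to\mathcal L(\mathcal H)$, continuous from the weak-$*$ topology of $H^\infty$ to the weak operator topology (equivalently, $\Phi(\varphi_j)\to\Phi(\varphi)$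 in the weak operator topology whenever $\sup_j\|\varphi_j\|_\infty<\infty$ and $\varphi_j\to\varphi$ pointwise on $\mathbb D$), with $\Phi(z)=T$. Theorem. Let $n\ge 1$ be an integer, let $T$ be a polynomially bounded operator on a complex Hilbert space $\mathcal H$, and suppose that there exist $\mathcal M_1,\dots,\mathcal M_n\in\operatorname{Lat}T$ such that for each $k=1,\dots,n$ the restriction $T|_{\mathcal M_k}$ is similar to $S$ (that is, $XT|_{\mathcal M_k}=SX$ for some bounded linear bijection $X:\mathcal M_k\to H^2$ with bounded inverse), and the closed linear span of $\mathcal M_1\cup\dots\cup\mathcal M_n$ is $\mathcal H$. Then $\mu_T\le n$ and $T$ is absolutely continuous. -/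

import Mathlib

noncomputable section

namespace ShiftType

open scoped Complex.UnitDisc

/-! ### Analytic functions on the open unit disc -/

/-- The extension by zero of a function on the open unit disc to the complex plane. -/
def discExt (f : 𝔻 → ℂ) : ℂ → ℂ := fun z =>
  if h : ‖z‖ < 1 then f (Complex.UnitDisc.mk z h) else 0

/-- `f` is analytic (holomorphic) on the open unit disc. -/
def IsAnalyticOnDisc (f : 𝔻 → ℂ) : Prop :=
  DifferentiableOn ℂ (discExt f) (Metric.ball 0 1)

theorem discExt_of_lt (f : 𝔻 → ℂ) {z : ℂ} (h : ‖z‖ < 1) :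
    discExt f z = f (Complex.UnitDisc.mk z h) := by
  simp [discExt, h]

theorem discExt_coe (f : 𝔻 → ℂ) (z : 𝔻) : discExt f (z : ℂ) = f z := by
  rw [discExt_of_lt f z.norm_lt_one, Complex.UnitDisc.mk_coe]

theorem discExt_add (f g : 𝔻 → ℂ) : discExt (f + g) = discExt f + discExt g := by
  funext z
  by_cases h : ‖z‖ < 1 <;> simp [discExt, h]

theorem discExt_mul (f g : 𝔻 → ℂ) : discExt (f * g) = discExt f * discExt g := by
  funext z
  by_cases h : ‖z‖ < 1 <;> simp [discExt, h]

theorem discExt_smul (c : ℂ) (f : 𝔻 → ℂ) : discExt (c • f) = c • discExt f := by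
  funext z
  by_cases h : ‖z‖ < 1 <;> simp [discExt, h]

theorem discExt_zero : discExt 0 = 0 := by
  funext z
  by_cases h : ‖z‖ < 1 <;> simp [discExt, h]

/-- Restrictions of functions analytic on the disc are analytic on the disc. -/
theorem isAnalyticOnDisc_of {F : ℂ → ℂ} (hF : DifferentiableOn ℂ F (Metric.ball 0 1)) :
    IsAnalyticOnDisc (fun z => F z) := by
  refine hF.congr fun z hz => ?_
  have h : ‖z‖ < 1 := by simpa using hz
  simp [discExt_of_lt _ h]

theorem IsAnalyticOnDisc.add {f g : 𝔻 → ℂ} (hf : IsAnalyticOnDisc f) (hg : IsAnalyticOnDisc g) :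
    IsAnalyticOnDisc (f + g) := by
  rw [IsAnalyticOnDisc, discExt_add]; exact DifferentiableOn.add hf hg

theorem IsAnalyticOnDisc.mul {f g : 𝔻 → ℂ} (hf : IsAnalyticOnDisc f) (hg : IsAnalyticOnDisc g) :
    IsAnalyticOnDisc (f * g) := by
  rw [IsAnalyticOnDisc, discExt_mul]; exact DifferentiableOn.mul hf hg

theorem IsAnalyticOnDisc.smul {f : 𝔻 → ℂ} (c : ℂ) (hf : IsAnalyticOnDisc f) :
    IsAnalyticOnDisc (c • f) := by
  rw [IsAnalyticOnDisc, discExt_smul]; exact DifferentiableOn.const_smul hf c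

/-! ### The algebra `H^∞` -/

/-- The Banach algebra `H^∞` of all bounded analytic functions on the open unit disc, with the
uniform norm. -/
def HInf : Subalgebra ℂ (BoundedContinuousFunction 𝔻 ℂ) where
  carrier := {φ | IsAnalyticOnDisc φ}
  mul_mem' {φ ψ} hφ hψ := by
    have := IsAnalyticOnDisc.mul (f := φ) (g := ψ) hφ hψ
    simpa using this
  add_mem' {φ ψ} hφ hψ := by
    have := IsAnalyticOnDisc.add (f := φ) (g := ψ) hφ hψ
    simpa using this
  algebraMap_mem' c := isAnalyticOnDisc_of (F := fun _ => c) (differentiableOn_const c)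

/-- The independent variable `z`, as an element of `H^∞`. -/
def HInf.coord : HInf :=
  ⟨BoundedContinuousFunction.ofNormedAddCommGroup (fun z : 𝔻 => (z : ℂ))
      Complex.UnitDisc.continuous_coe 1 (fun z => z.norm_lt_one.le),
    isAnalyticOnDisc_of (F := fun z => z) differentiableOn_id⟩

/-! ### The Hardy space `H^2` and the unilateral shift -/

/-- The quadratic mean of `f` over the circle of radius `r` about `0`, that is
`(1 / 2π ∫₀^{2π} |f(r e^{iθ})|² dθ)^{1/2}`. -/
def quadMean (f : 𝔻 → ℂ) (r : ℝ) : ℝ :=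
  Real.sqrt (Real.circleAverage (fun z => ‖discExt f z‖ ^ 2) 0 r)

/-- The Hardy norm: the supremum of the quadratic means over the radii `0 < r < 1`. -/
def hardyNorm (f : 𝔻 → ℂ) : ℝ := ⨆ r : Set.Ioo (0 : ℝ) 1, quadMean f r

/-- The quadratic means of `f` are bounded. -/
def HasBddMeans (f : 𝔻 → ℂ) : Prop :=
  BddAbove (Set.range fun r : Set.Ioo (0 : ℝ) 1 => quadMean f r)

theorem quadMean_nonneg (f : 𝔻 → ℂ) (r : ℝ) : 0 ≤ quadMean f r := Real.sqrt_nonneg _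

theorem IsAnalyticOnDisc.continuous_circle {f : 𝔻 → ℂ} (hf : IsAnalyticOnDisc f)
    (r : Set.Ioo (0 : ℝ) 1) : Continuous fun θ : ℝ => discExt f (circleMap 0 r θ) := by
  refine hf.continuousOn.comp_continuous (continuous_circleMap 0 _) fun θ => ?_
  simp [abs_of_pos r.2.1, r.2.2]

theorem IsAnalyticOnDisc.circleIntegrable {f : 𝔻 → ℂ} (hf : IsAnalyticOnDisc f)
    (r : Set.Ioo (0 : ℝ) 1) : CircleIntegrable (fun z => ‖discExt f z‖ ^ 2) 0 r :=
  ((hf.continuous_circle r).norm.pow 2).intervalIntegrable _ _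

/-- The normalized Lebesgue measure in the angular variable. -/
def angleMeasure : MeasureTheory.Measure ℝ :=
  ENNReal.ofReal (2 * Real.pi)⁻¹ • MeasureTheory.volume.restrict (Set.Ioc 0 (2 * Real.pi))

theorem IsAnalyticOnDisc.memLp {f : 𝔻 → ℂ} (hf : IsAnalyticOnDisc f) (r : Set.Ioo (0 : ℝ) 1) :
    MeasureTheory.MemLp (fun θ : ℝ => discExt f (circleMap 0 r θ)) 2 angleMeasure := by
  refine MeasureTheory.MemLp.smul_measure ?_ ENNReal.ofReal_ne_top
  have hc := hf.continuous_circle r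
  obtain ⟨C, hC⟩ := (isCompact_Icc (a := (0 : ℝ)) (b := 2 * Real.pi)).exists_bound_of_continuousOn
    hc.continuousOn
  refine MeasureTheory.MemLp.of_bound hc.aestronglyMeasurable C ?_
  filter_upwards [MeasureTheory.ae_restrict_mem measurableSet_Ioc] with θ hθ
  exact hC θ ⟨hθ.1.le, hθ.2⟩

theorem IsAnalyticOnDisc.quadMean_eq {f : 𝔻 → ℂ} (hf : IsAnalyticOnDisc f)
    (r : Set.Ioo (0 : ℝ) 1) :
    quadMean f r =
      (MeasureTheory.eLpNorm (fun θ : ℝ => discExt f (circleMap 0 r θ)) 2 angleMeasure).toReal := by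
  rw [(hf.memLp r).eLpNorm_eq_integral_rpow_norm (by norm_num) (by norm_num),
    ENNReal.toReal_ofReal (by positivity), quadMean, Real.sqrt_eq_rpow, Real.circleAverage_def,
    angleMeasure, MeasureTheory.integral_smul_measure,
    intervalIntegral.integral_of_le (by positivity),
    ENNReal.toReal_ofReal (by positivity)]
  norm_num

theorem quadMean_add_le {f g : 𝔻 → ℂ} (hf : IsAnalyticOnDisc f) (hg : IsAnalyticOnDisc g)
    (r : Set.Ioo (0 : ℝ) 1) : quadMean (f + g) r ≤ quadMean f r + quadMean g r := by
  rw [(hf.add hg).quadMean_eq r, hf.quadMean_eq r, hg.quadMean_eq r,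
    ← ENNReal.toReal_add (hf.memLp r).2.ne (hg.memLp r).2.ne, discExt_add]
  exact ENNReal.toReal_mono (ENNReal.add_ne_top.2 ⟨(hf.memLp r).2.ne, (hg.memLp r).2.ne⟩)
    (MeasureTheory.eLpNorm_add_le (hf.memLp r).1 (hg.memLp r).1 (by norm_num))

theorem quadMean_smul (c : ℂ) (f : 𝔻 → ℂ) (r : ℝ) : quadMean (c • f) r = ‖c‖ * quadMean f r := by
  have : (fun z => ‖discExt (c • f) z‖ ^ 2) = fun z => ‖c‖ ^ 2 • ‖discExt f z‖ ^ 2 := by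
    funext z
    simp [discExt_smul, mul_pow]
  rw [quadMean, this, Real.circleAverage_fun_smul, smul_eq_mul,
    Real.sqrt_mul (by positivity), Real.sqrt_sq (norm_nonneg _), quadMean]

theorem quadMean_zero (r : ℝ) : quadMean 0 r = 0 := by
  simp [quadMean, discExt_zero, Real.circleAverage_def]

theorem quadMean_coord_mul_le {f : 𝔻 → ℂ} (hf : IsAnalyticOnDisc f) (r : Set.Ioo (0 : ℝ) 1) :
    quadMean ((fun z : 𝔻 => (z : ℂ)) * f) r ≤ quadMean f r := by
  have hz : IsAnalyticOnDisc (fun z : 𝔻 => (z : ℂ)) :=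
    isAnalyticOnDisc_of (F := fun z => z) differentiableOn_id
  refine Real.sqrt_le_sqrt (Real.circleAverage_mono ((hz.mul hf).circleIntegrable r)
    (hf.circleIntegrable r) fun z hzr => ?_)
  have h1 : ‖z‖ < 1 := by
    have : ‖z‖ = |(r : ℝ)| := by simpa using hzr
    rw [this, abs_of_pos r.2.1]; exact r.2.2
  simp only [discExt_of_lt _ h1, Pi.mul_apply, norm_mul, Complex.UnitDisc.coe_mk]
  gcongr
  exact mul_le_of_le_one_left (norm_nonneg _) h1.le

/-- The Hardy space `H^2` as a linear space of functions: the analytic functions on the open unit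
disc with bounded quadratic means. -/
def hardySubmodule : Submodule ℂ (𝔻 → ℂ) where
  carrier := {f | IsAnalyticOnDisc f ∧ HasBddMeans f}
  zero_mem' := by
    refine ⟨isAnalyticOnDisc_of (F := fun _ => 0) (differentiableOn_const 0), 0, ?_⟩
    rintro _ ⟨r, rfl⟩
    exact (quadMean_zero _).le
  add_mem' := by
    rintro f g ⟨hf, C, hC⟩ ⟨hg, D, hD⟩
    refine ⟨hf.add hg, C + D, ?_⟩
    rintro _ ⟨r, rfl⟩
    exact (quadMean_add_le hf hg r).trans (add_le_add (hC ⟨r, rfl⟩) (hD ⟨r, rfl⟩))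
  smul_mem' := by
    rintro c f ⟨hf, C, hC⟩
    refine ⟨hf.smul c, ‖c‖ * C, ?_⟩
    rintro _ ⟨r, rfl⟩
    simp only [quadMean_smul]
    exact mul_le_mul_of_nonneg_left (hC ⟨r, rfl⟩) (norm_nonneg _)

/-- The Hardy space `H^2` on the open unit disc; its norm is `hardyNorm`. -/
def H2 : Type := hardySubmodule

instance : AddCommGroup H2 := inferInstanceAs (AddCommGroup hardySubmodule)

instance : Module ℂ H2 := inferInstanceAs (Module ℂ hardySubmodule)

/-- The function on the disc underlying an element of `H^2`. -/
def H2.toFun : H2 →ₗ[ℂ] (𝔻 → ℂ) := hardySubmodule.subtype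

theorem H2.isAnalytic (f : H2) : IsAnalyticOnDisc f.toFun := f.2.1

theorem H2.hasBddMeans (f : H2) : HasBddMeans f.toFun := f.2.2

theorem H2.quadMean_le (f : H2) (r : Set.Ioo (0 : ℝ) 1) :
    quadMean f.toFun r ≤ hardyNorm f.toFun := le_ciSup f.hasBddMeans r

theorem hardyNorm_le {f : 𝔻 → ℂ} {C : ℝ} (h : ∀ r : Set.Ioo (0 : ℝ) 1, quadMean f r ≤ C) :
    hardyNorm f ≤ C :=
  haveI : Nonempty (Set.Ioo (0 : ℝ) 1) := ⟨⟨1 / 2, by norm_num⟩⟩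
  ciSup_le h

theorem hardyNorm_nonneg (f : 𝔻 → ℂ) : 0 ≤ hardyNorm f :=
  Real.iSup_nonneg fun _ => quadMean_nonneg _ _

theorem hardyNorm_smul_le (c : ℂ) (f : H2) :
    hardyNorm (c • f).toFun ≤ ‖c‖ * hardyNorm f.toFun := by
  refine hardyNorm_le fun r => ?_
  rw [map_smul, quadMean_smul]
  exact mul_le_mul_of_nonneg_left (f.quadMean_le r) (norm_nonneg _)

theorem H2.eq_zero_of_hardyNorm (f : H2) (h : hardyNorm f.toFun = 0) : f = 0 := by
  have key : ∀ z : ℂ, 0 < ‖z‖ → ‖z‖ < 1 → discExt f.toFun z = 0 := by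
    intro z h0 h1
    let r : Set.Ioo (0 : ℝ) 1 := ⟨‖z‖, h0, h1⟩
    have hq : quadMean f.toFun r = 0 :=
      le_antisymm ((f.quadMean_le r).trans h.le) (quadMean_nonneg _ _)
    have hc : Continuous fun θ : ℝ => ‖discExt f.toFun (circleMap 0 r θ)‖ ^ 2 :=
      (f.isAnalytic.continuous_circle r).norm.pow 2
    have hi : ∫ θ in (0 : ℝ)..(2 * Real.pi), ‖discExt f.toFun (circleMap 0 r θ)‖ ^ 2 = 0 := by
      have hnn : 0 ≤ ∫ θ in (0 : ℝ)..(2 * Real.pi), ‖discExt f.toFun (circleMap 0 r θ)‖ ^ 2 :=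
        intervalIntegral.integral_nonneg (by positivity) fun θ _ => by positivity
      rw [quadMean, Real.circleAverage_def, Real.sqrt_eq_zero (by
        rw [smul_eq_mul]; positivity), smul_eq_mul] at hq
      have hp : (2 * Real.pi)⁻¹ ≠ 0 := by positivity
      exact (mul_eq_zero.1 hq).resolve_left hp
    obtain ⟨θ, hθ, hzθ⟩ : ∃ θ ∈ Set.Ioc (0 : ℝ) (2 * Real.pi), circleMap 0 r θ = z := by
      have hz : z ∈ Metric.sphere (0 : ℂ) |(r : ℝ)| := by simp [r]
      rw [← image_circleMap_Ioc] at hz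
      exact hz
    by_contra hne
    have hpos : 0 < ∫ θ in (0 : ℝ)..(2 * Real.pi), ‖discExt f.toFun (circleMap 0 r θ)‖ ^ 2 :=
      intervalIntegral.integral_pos (by positivity) hc.continuousOn (fun _ _ => by positivity)
        ⟨θ, ⟨hθ.1.le, hθ.2⟩, by rw [hzθ]; positivity⟩
    exact hpos.ne' hi
  have hcont : ContinuousAt (discExt f.toFun) 0 :=
    f.isAnalytic.continuousOn.continuousAt (Metric.ball_mem_nhds 0 one_pos)
  have h0 : discExt f.toFun 0 = 0 := by
    have ht : Filter.Tendsto (discExt f.toFun) (nhdsWithin 0 {0}ᶜ) (nhds (discExt f.toFun 0)) :=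
      hcont.tendsto.mono_left nhdsWithin_le_nhds
    refine tendsto_nhds_unique ht (tendsto_const_nhds.congr' ?_)
    filter_upwards [self_mem_nhdsWithin,
      mem_nhdsWithin_of_mem_nhds (Metric.ball_mem_nhds (0 : ℂ) one_pos)] with z hz hz1
    exact (key z (norm_pos_iff.2 hz) (by simpa using hz1)).symm
  refine Subtype.ext (funext fun z => ?_)
  change f.toFun z = 0
  rw [← discExt_coe f.toFun z]
  by_cases hz : (z : ℂ) = 0
  · rw [hz, h0]
  · exact key z (norm_pos_iff.2 hz) z.norm_lt_one

instance : NormedAddCommGroup H2 :=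
  AddGroupNorm.toNormedAddCommGroup
    { toFun := fun f => hardyNorm f.toFun
      map_zero' := le_antisymm
        (hardyNorm_le fun r => by rw [map_zero, quadMean_zero]) (hardyNorm_nonneg _)
      add_le' := fun f g => hardyNorm_le fun r => by
        rw [map_add]
        exact (quadMean_add_le f.isAnalytic g.isAnalytic r).trans
          (add_le_add (f.quadMean_le r) (g.quadMean_le r))
      neg' := fun f => by
        have h1 := hardyNorm_smul_le (-1) f
        have h2 := hardyNorm_smul_le (-1) (-f)
        simp only [neg_smul, one_smul, neg_neg, norm_neg, norm_one, one_mul] at h1 h2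
        exact le_antisymm h1 h2
      eq_zero_of_map_eq_zero' := fun f h => f.eq_zero_of_hardyNorm h }

theorem H2.norm_def (f : H2) : ‖f‖ = hardyNorm f.toFun := rfl

instance : NormedSpace ℂ H2 where
  norm_smul_le c f := hardyNorm_smul_le c f

/-- Multiplication by the independent variable on `H^2`, as a map. -/
def H2.mulCoord (f : H2) : H2 :=
  ⟨(fun z : 𝔻 => (z : ℂ)) * f.toFun,
    (isAnalyticOnDisc_of (F := fun z => z) differentiableOn_id).mul f.isAnalytic,
    hardyNorm f.toFun, by
      rintro _ ⟨r, rfl⟩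
      exact (quadMean_coord_mul_le f.isAnalytic r).trans (f.quadMean_le r)⟩

theorem H2.mulCoord_toFun (f : H2) : f.mulCoord.toFun = (fun z : 𝔻 => (z : ℂ)) * f.toFun := rfl

theorem H2.toFun_injective : Function.Injective H2.toFun := Subtype.coe_injective

/-- The simple unilateral shift `S`: multiplication by the independent variable on `H^2`. -/
def S : H2 →L[ℂ] H2 :=
  LinearMap.mkContinuous
    { toFun := H2.mulCoord
      map_add' := fun f g => H2.toFun_injective (by
        rw [map_add, H2.mulCoord_toFun, H2.mulCoord_toFun, H2.mulCoord_toFun, map_add, mul_add])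
      map_smul' := fun c f => H2.toFun_injective (by
        rw [map_smul, H2.mulCoord_toFun, H2.mulCoord_toFun, map_smul, mul_smul_comm,
          RingHom.id_apply]) }
    1 fun f => by
      rw [one_mul]
      exact hardyNorm_le fun r => (quadMean_coord_mul_le f.isAnalytic r).trans (f.quadMean_le r)

theorem S_apply (f : H2) (z : 𝔻) : (S f).toFun z = z * f.toFun z := rfl

/-! ### Operators -/

section Operators

variable {E F H : Type*} [NormedAddCommGroup E] [NormedSpace ℂ E]
  [NormedAddCommGroup F] [NormedSpace ℂ F] [NormedAddCommGroup H] [InnerProductSpace ℂ H]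

/-- `T ≈ R`: there is a bounded linear bijection `X` with bounded inverse and `X T = R X`. -/
def Similar (T : E →L[ℂ] E) (R : F →L[ℂ] F) : Prop :=
  ∃ X : E ≃L[ℂ] F, ∀ x, X (T x) = R (X x)

/-- `Lat T`: the closed linear subspaces `M` with `T M ⊆ M`. -/
def Lat (T : H →L[ℂ] H) : Set (Submodule ℂ H) :=
  {M | IsClosed (M : Set H) ∧ ∀ x ∈ M, T x ∈ M}

/-- The restriction `T|_M` of `T` to an invariant subspace. -/
def restrictLat (T : H →L[ℂ] H) {M : Submodule ℂ H} (hM : M ∈ Lat T) : M →L[ℂ] M :=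
  (T.comp M.subtypeL).codRestrict M fun x => hM.2 x x.2

/-- `‖p(T)‖ ≤ C ‖p‖_∞` for every polynomial `p`, where `‖p‖_∞` is the uniform norm on the disc. -/
def IsPolynomiallyBounded (T : H →L[ℂ] H) : Prop :=
  ∃ C : ℝ, ∀ p : Polynomial ℂ, ‖Polynomial.aeval T p‖ ≤ C * ⨆ z : 𝔻, ‖p.eval (z : ℂ)‖

/-- The closed linear span of all `T ^ j x_k`. -/
def cyclicSpan (T : H →L[ℂ] H) {ι : Type*} (x : ι → H) : Submodule ℂ H :=
  (Submodule.span ℂ (Set.range fun q : ι × ℕ => (T ^ q.2) (x q.1))).topologicalClosure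

/-- The multiplicity `μ_T ∈ {1, 2, …, ∞}`: the least number `n ≥ 1` of vectors `x_1, …, x_n` whose
orbits under `T` span the whole space, and `∞` if there is no such finite number. -/
def opMultiplicity (T : H →L[ℂ] H) : ℕ∞ :=
  sInf {m : ℕ∞ | ∃ n : ℕ, m = n ∧ 1 ≤ n ∧ ∃ x : Fin n → H, cyclicSpan T x = ⊤}

/-- `T` is absolutely continuous: it admits an `H^∞`-functional calculus, that is, a bounded unital
algebra homomorphism `Φ : H^∞ → L(H)` with `Φ(z) = T`, continuous from the weak-star topology of
`H^∞` to the weak operator topology. A sequence in `H^∞` converges weak-star if and only if it is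
bounded in norm and converges at every point of the disc, and (the predual of `H^∞` being
separable) weak-star continuity of a linear functional can be tested on sequences. -/
def IsAbsolutelyContinuous (T : H →L[ℂ] H) : Prop :=
  ∃ Φ : HInf →ₐ[ℂ] (H →L[ℂ] H), Continuous Φ ∧ Φ HInf.coord = T ∧
    ∀ (φ : ℕ → HInf) (ψ : HInf), (∃ C : ℝ, ∀ j, ‖φ j‖ ≤ C) →
      (∀ z : 𝔻, Filter.Tendsto (fun j => (φ j : BoundedContinuousFunction 𝔻 ℂ) z) Filter.atTop
        (nhds ((ψ : BoundedContinuousFunction 𝔻 ℂ) z))) →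
      ∀ x y : H, Filter.Tendsto (fun j => inner ℂ y (Φ (φ j) x)) Filter.atTop
        (nhds (inner ℂ y (Φ ψ x)))

end Operators

end ShiftType

end

/-!
Let `Y k : H^2 → H` be the inverse of the similarity `M k → H^2`, followed by the inclusion of
`M k` in `H`. Then `T Y = Y S` for each of these maps, and their ranges span a dense subspace. Both
claims are proved for any polynomially bounded operator with such a family of intertwining maps.

The facts needed about `H^2` all come from weak convergence. Since some `M k` is a closed subspace
of `H`, the space `H^2` is isomorphic to a Hilbert space, and the vectors representing the point
evaluations span a dense subspace of it. Hence a bounded sequence in `H^2` which converges at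
every point of the disc converges weakly (`H2.tendsto_dual_of_tendsto_eval`). Taylor polynomials
of dilations of a function `f` in `H^2` form a bounded sequence converging to `f` at every point,
and by Mazur's theorem weak limits of elements of a convex set are in its norm closure. This gives
two things: the polynomials are dense in `H^2` (`H2.dense_span_S_pow_one`), and every `φ` in `H^∞`
admits polynomials `q j` with uniform norms at most `‖φ‖ + 1` for which multiplication by `q j`
tends strongly to multiplication by `φ` (`HInf.exists_polynomial_tendsto_mulOp`).

Multiplicity: since `1` is cyclic for `S`, the vectors `Y k 1` together are cyclic for `T`
(`cyclicSpan_of_intertwining`).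

Absolute continuity: the operators `q j (T)` are uniformly bounded, because `T` is polynomially
bounded, and `q j (T) Y = Y q j (S)` converges strongly to `Y M_φ`, where `M_φ` is the
multiplication by `φ`. As the ranges of the maps `Y` span a dense subspace, `q j (T)` has a strong
limit `Φ(φ)`. It is the only bounded operator with `Φ(φ) Y = Y M_φ` for all `Y`, so `Φ` is an
algebra homomorphism. Its continuity on bounded pointwise convergent sequences needs to be checked
only on the ranges of the maps `Y`, where it is the weak convergence in `H^2`
(`isAbsolutelyContinuous_of_intertwining`).
-/

noncomputable section

namespace ShiftType

open scoped Complex.UnitDisc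
open Filter Topology Polynomial

/-! ### Convergence of bounded families of operators -/

section Convergence

variable {E F : Type*} [NormedAddCommGroup E] [NormedSpace ℂ E]
  [NormedAddCommGroup F] [NormedSpace ℂ F]

/-- A bounded family of operators which tends to zero pointwise on a set with dense linear span
tends to zero pointwise everywhere. The filter is arbitrary: the filter `atTop` on `ℕ × ℕ` covers
the differences in the Cauchy criterion. -/
theorem tendsto_zero_of_dense_span {ι : Type*} {l : Filter ι} {A : ι → E →L[ℂ] F} {K : ℝ}
    (hK : ∀ i, ‖A i‖ ≤ K) {s : Set E} (hs : (Submodule.span ℂ s).topologicalClosure = ⊤)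
    (h : ∀ x ∈ s, Tendsto (fun i => A i x) l (𝓝 0)) (x : E) :
    Tendsto (fun i => A i x) l (𝓝 0) := by
  have hspan : ∀ y ∈ Submodule.span ℂ s, Tendsto (fun i => A i y) l (𝓝 0) := by
    intro y hy
    induction hy using Submodule.span_induction with
    | mem y hy => exact h y hy
    | zero => simpa using tendsto_const_nhds
    | add y z _ _ hy hz => simpa using hy.add hz
    | smul c y _ hy => simpa using hy.const_smul c
  have hx : x ∈ closure (Submodule.span ℂ s : Set E) := by
    rw [← Submodule.topologicalClosure_coe, hs]; trivial
  rw [Metric.tendsto_nhds]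
  intro ε hε
  have hδ : 0 < ε / 2 / (|K| + 1) := by positivity
  obtain ⟨y, hy, hxy⟩ := Metric.mem_closure_iff.1 hx _ hδ
  filter_upwards [Metric.tendsto_nhds.1 (hspan y hy) (ε / 2) (half_pos hε)] with i hi
  rw [dist_zero_right] at hi ⊢
  rw [dist_eq_norm, lt_div_iff₀ (by positivity)] at hxy
  have h1 : ‖A i (x - y)‖ ≤ ‖x - y‖ * (|K| + 1) := by
    refine ((A i).le_of_opNorm_le (hK i) _).trans ?_
    rw [mul_comm]
    gcongr
    linarith [le_abs_self K]
  calc ‖A i x‖ = ‖A i (x - y) + A i y‖ := by rw [← map_add, sub_add_cancel]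
    _ ≤ ‖A i (x - y)‖ + ‖A i y‖ := norm_add_le _ _
    _ < ε := by linarith

theorem tendsto_of_dense_span {A : ℕ → E →L[ℂ] F} {B : E →L[ℂ] F} {K : ℝ}
    (hK : ∀ j, ‖A j‖ ≤ K) {s : Set E} (hs : (Submodule.span ℂ s).topologicalClosure = ⊤)
    (h : ∀ x ∈ s, Tendsto (fun j => A j x) atTop (𝓝 (B x))) (x : E) :
    Tendsto (fun j => A j x) atTop (𝓝 (B x)) := by
  refine tendsto_sub_nhds_zero_iff.1 <| tendsto_zero_of_dense_span (A := fun j => A j - B)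
    (K := K + ‖B‖) (fun j => (norm_sub_le _ _).trans (by linarith [hK j])) hs (fun y hy => ?_) x
  exact tendsto_sub_nhds_zero_iff.2 (h y hy)

/-- A bounded sequence of operators which converges pointwise on a set with dense linear span
converges strongly. -/
theorem exists_tendsto_of_dense_span [CompleteSpace E] [CompleteSpace F] {A : ℕ → E →L[ℂ] F}
    {K : ℝ} (hK : ∀ j, ‖A j‖ ≤ K) {s : Set E}
    (hs : (Submodule.span ℂ s).topologicalClosure = ⊤)
    (h : ∀ x ∈ s, ∃ y, Tendsto (fun j => A j x) atTop (𝓝 y)) :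
    ∃ B : E →L[ℂ] F, ‖B‖ ≤ K ∧ ∀ x, Tendsto (fun j => A j x) atTop (𝓝 (B x)) := by
  have hc : ∀ x, ∃ y, Tendsto (fun j => A j x) atTop (𝓝 y) := by
    intro x
    refine cauchySeq_tendsto_of_complete (cauchySeq_iff_tendsto_dist_atTop_0.2 ?_)
    simp only [dist_eq_norm]
    refine tendsto_zero_iff_norm_tendsto_zero.1 (tendsto_zero_of_dense_span
      (A := fun p : ℕ × ℕ => A p.1 - A p.2) (K := K + K)
      (fun p => (norm_sub_le _ _).trans (add_le_add (hK _) (hK _))) hs (fun y hy => ?_) x)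
    obtain ⟨z, hz⟩ := h y hy
    refine tendsto_zero_iff_norm_tendsto_zero.2 ?_
    simpa [dist_eq_norm] using cauchySeq_iff_tendsto_dist_atTop_0.1 hz.cauchySeq
  choose B hB using hc
  refine ⟨continuousLinearMapOfTendsto A (tendsto_pi_nhds.2 hB), ?_, hB⟩
  refine ContinuousLinearMap.opNorm_le_bound _ ((norm_nonneg _).trans (hK 0)) fun x => ?_
  exact le_of_tendsto (hB x).norm (Eventually.of_forall fun j => (A j).le_of_opNorm_le (hK j) x)

/-- Mazur's theorem for sequences: the weak limit of a sequence in a convex set lies in the norm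
closure of the set. -/
theorem mem_closure_of_forall_dual_tendsto {s : Set E} (hs : Convex ℝ s) {u : ℕ → E} {x : E}
    (hu : ∀ j, u j ∈ s)
    (h : ∀ ℓ : E →L[ℂ] ℂ, Tendsto (fun j => ℓ (u j)) atTop (𝓝 (ℓ x))) : x ∈ closure s := by
  by_contra hx
  obtain ⟨ℓ, c, hc, hxc⟩ := RCLike.geometric_hahn_banach_closed_point (𝕜 := ℂ) hs.closure
    isClosed_closure hx
  refine hxc.not_ge (le_of_tendsto ((Complex.continuous_re.tendsto _).comp (h ℓ))
    (Eventually.of_forall fun j => (hc _ (subset_closure (hu j))).le))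

end Convergence

/-! ### Quadratic means and dilations -/

theorem quadMean_le_of_norm_le {f : 𝔻 → ℂ} (hf : IsAnalyticOnDisc f) {c : ℝ} (hc : 0 ≤ c)
    (h : ∀ z, ‖f z‖ ≤ c) (r : Set.Ioo (0 : ℝ) 1) : quadMean f r ≤ c := by
  refine Real.sqrt_le_iff.2 ⟨hc, Real.circleAverage_mono_on_of_le_circle (hf.circleIntegrable r)
    fun z hz => ?_⟩
  have h1 : ‖z‖ < 1 := by
    have : ‖z‖ = |(r : ℝ)| := by simpa using hz
    rw [this, abs_of_pos r.2.1]; exact r.2.2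
  rw [discExt_of_lt _ h1]
  gcongr
  exact h _

theorem quadMean_mul_le {φ f : 𝔻 → ℂ} (hφ : IsAnalyticOnDisc φ) (hf : IsAnalyticOnDisc f) {c : ℝ}
    (hc : 0 ≤ c) (h : ∀ z, ‖φ z‖ ≤ c) (r : Set.Ioo (0 : ℝ) 1) :
    quadMean (φ * f) r ≤ c * quadMean f r := by
  have hcf : c * quadMean f r = quadMean ((c : ℂ) • f) r := by
    rw [quadMean_smul, Complex.norm_real, Real.norm_of_nonneg hc]
  rw [hcf]
  refine Real.sqrt_le_sqrt (Real.circleAverage_mono ((hφ.mul hf).circleIntegrable r)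
    ((hf.smul _).circleIntegrable r) fun z hz => ?_)
  have h1 : ‖z‖ < 1 := by
    have : ‖z‖ = |(r : ℝ)| := by simpa using hz
    rw [this, abs_of_pos r.2.1]; exact r.2.2
  simp only [discExt_of_lt _ h1, Pi.mul_apply, Pi.smul_apply, smul_eq_mul, norm_mul,
    Complex.norm_real, Real.norm_of_nonneg hc]
  gcongr
  exact h _

/-- Point values are controlled by quadratic means, by Cauchy's integral formula for `f ^ 2`. -/
theorem IsAnalyticOnDisc.norm_sq_le {f : 𝔻 → ℂ} (hf : IsAnalyticOnDisc f) {z : 𝔻}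
    (r : Set.Ioo (0 : ℝ) 1) (hz : ‖(z : ℂ)‖ < r) :
    ‖f z‖ ^ 2 ≤ r / (r - ‖(z : ℂ)‖) * quadMean f r ^ 2 := by
  have hr : |(r : ℝ)| = r := abs_of_pos r.2.1
  have hd : DiffContOnCl ℂ (fun w => discExt f w ^ 2) (Metric.ball 0 |(r : ℝ)|) := by
    refine DifferentiableOn.diffContOnCl ((DifferentiableOn.pow hf 2).mono ?_)
    rw [hr]
    exact Metric.closure_ball_subset_closedBall.trans (Metric.closedBall_subset_ball r.2.2)
  have hC := hd.circleAverage_smul_div (w := (z : ℂ)) (by simpa [hr] using hz)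
  rw [discExt_coe] at hC
  have hnn : 0 ≤ Real.circleAverage (fun w => ‖discExt f w‖ ^ 2) 0 r :=
    Real.circleAverage_nonneg_of_nonneg fun w _ => by positivity
  rw [← norm_pow, ← hC, quadMean, Real.sq_sqrt hnn, ← smul_eq_mul, ← Real.circleAverage_fun_smul]
  rw [Real.circleAverage_def, Real.circleAverage_def, norm_smul, smul_eq_mul,
    Real.norm_of_nonneg (by positivity : (0 : ℝ) ≤ (2 * Real.pi)⁻¹)]
  gcongr
  have hf' := hf.continuous_circle r
  have hc : Continuous fun θ =>
      ((r : ℝ) / (r - ‖(z : ℂ)‖)) • ‖discExt f (circleMap 0 r θ)‖ ^ 2 := by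
    fun_prop
  refine intervalIntegral.norm_integral_le_of_norm_le (by positivity)
    (Eventually.of_forall fun θ _ => ?_)
    (hc.intervalIntegrable _ _)
  have hn : ‖circleMap 0 (r : ℝ) θ‖ = r := by simp [hr]
  have hlt : 0 < (r : ℝ) - ‖(z : ℂ)‖ := sub_pos.2 hz
  have hle := norm_sub_norm_le (circleMap 0 (r : ℝ) θ) z
  rw [hn] at hle
  have hr0 : 0 ≤ (r : ℝ) := r.2.1.le
  rw [norm_smul, norm_div, sub_zero, hn, norm_pow, smul_eq_mul]
  gcongr

theorem IsAnalyticOnDisc.dilate {f : 𝔻 → ℂ} (hf : IsAnalyticOnDisc f) (r : Set.Ioo (0 : ℝ) 1) :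
    IsAnalyticOnDisc fun z => discExt f (r * z) := by
  refine isAnalyticOnDisc_of (F := fun z => discExt f (r * z))
    (DifferentiableOn.comp hf (by fun_prop) fun z hz => ?_)
  have hz' : ‖z‖ < 1 := by simpa using hz
  have : |(r : ℝ)| * ‖z‖ < 1 := by
    rw [abs_of_pos r.2.1]
    exact mul_lt_one_of_nonneg_of_lt_one_left r.2.1.le r.2.2 hz'.le
  simpa using this

theorem quadMean_dilate (f : 𝔻 → ℂ) (r ρ : Set.Ioo (0 : ℝ) 1) :
    quadMean (fun z => discExt f (r * z)) ρ = quadMean f ((r : ℝ) * ρ) := by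
  rw [quadMean, quadMean, Real.circleAverage_def, Real.circleAverage_def]
  congr 4 with θ
  have h : ‖circleMap 0 (ρ : ℝ) θ‖ < 1 := by simp [abs_of_pos ρ.2.1, ρ.2.2]
  rw [discExt_of_lt _ h]
  simp [circleMap, mul_assoc]

/-- The dilations of an analytic function are uniform limits of Taylor polynomials: the Taylor
series converges uniformly on smaller discs. -/
theorem IsAnalyticOnDisc.exists_polynomial_norm_sub_dilate_le {f : 𝔻 → ℂ}
    (hf : IsAnalyticOnDisc f) (r : Set.Ioo (0 : ℝ) 1) {ε : ℝ} (hε : 0 < ε) :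
    ∃ q : ℂ[X], ∀ z : 𝔻, ‖q.eval (z : ℂ) - discExt f (r * z)‖ ≤ ε := by
  -- The power series is taken on a disc whose radius `R` lies strictly between `r` and `1`.
  obtain ⟨R, hrR, hR1⟩ := exists_between r.2.2
  have hR0 : 0 < R := r.2.1.trans hrR
  lift R to NNReal using hR0.le
  obtain ⟨s, hs⟩ : ∃ s : NNReal, (s : ℝ) = r := ⟨⟨r, r.2.1.le⟩, rfl⟩
  have hps := DifferentiableOn.hasFPowerSeriesOnBall (R := R) (c := 0)
    (DifferentiableOn.mono hf (Metric.closedBall_subset_ball hR1)) (by exact_mod_cast hR0)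
  have hu := hps.tendstoUniformlyOn (r' := s) (by
    rw [ENNReal.coe_lt_coe, ← NNReal.coe_lt_coe, hs]; exact hrR)
  obtain ⟨N, hN⟩ := (Metric.tendstoUniformlyOn_iff.1 hu ε hε).exists
  set p := cauchyPowerSeries (discExt f) 0 R
  refine ⟨∑ k ∈ Finset.range N, C (p.coeff k * (r : ℂ) ^ k) * X ^ k, fun z => ?_⟩
  have h := hN (r * z) (by
    have : |(r : ℝ)| * ‖(z : ℂ)‖ < s := by
      rw [abs_of_pos r.2.1, hs]
      exact mul_lt_of_lt_one_right r.2.1 z.norm_lt_one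
    simpa using this)
  rw [zero_add, dist_comm, dist_eq_norm] at h
  have hq : (∑ k ∈ Finset.range N, C (p.coeff k * (r : ℂ) ^ k) * X ^ k).eval (z : ℂ) =
      p.partialSum N (r * z) := by
    rw [eval_finsetSum, FormalMultilinearSeries.partialSum]
    refine Finset.sum_congr rfl fun k _ => ?_
    rw [FormalMultilinearSeries.apply_eq_pow_smul_coeff, eval_C_mul, eval_pow, eval_X,
      smul_eq_mul, mul_pow]
    ring
  rw [hq]
  exact h.le

/-- Every analytic function on the disc is a pointwise limit of polynomials which stay uniformly
close to its dilations. -/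
theorem IsAnalyticOnDisc.exists_polynomial_tendsto {f : 𝔻 → ℂ} (hf : IsAnalyticOnDisc f) :
    ∃ (r : ℕ → Set.Ioo (0 : ℝ) 1) (q : ℕ → ℂ[X]),
      (∀ j (z : 𝔻), ‖(q j).eval (z : ℂ) - discExt f (r j * z)‖ ≤ 1) ∧
      ∀ z : 𝔻, Tendsto (fun j => (q j).eval (z : ℂ)) atTop (𝓝 (f z)) := by
  obtain ⟨r, -, hr, hr1⟩ := exists_seq_strictMono_tendsto' (zero_lt_one (α := ℝ))
  choose q hq using fun j : ℕ => hf.exists_polynomial_norm_sub_dilate_le ⟨r j, hr j⟩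
    (ε := 1 / ((j : ℝ) + 1)) (by positivity)
  refine ⟨fun j => ⟨r j, hr j⟩, q, fun j z => (hq j z).trans ?_, fun z => ?_⟩
  · rw [div_le_one (by positivity)]; linarith [(Nat.cast_nonneg j : (0 : ℝ) ≤ j)]
  · have h1 : Tendsto (fun j => (q j).eval (z : ℂ) - discExt f (r j * z)) atTop (𝓝 0) :=
      squeeze_zero_norm (fun j => hq j z) tendsto_one_div_add_atTop_nhds_zero_nat
    have h2 : Tendsto (fun j => (r j : ℂ) * z) atTop (𝓝 z) := by
      simpa using ((Complex.continuous_ofReal.tendsto 1).comp hr1).mul_const (z : ℂ)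
    have h3 : ContinuousAt (discExt f) z :=
      hf.continuousOn.continuousAt (Metric.isOpen_ball.mem_nhds (by simpa using z.norm_lt_one))
    have h4 := h1.add (h3.tendsto.comp h2)
    rw [discExt_coe, zero_add] at h4
    simpa using h4

/-! ### Point evaluations and multiplication operators on `H^2` -/

theorem H2.norm_toFun_le (z : 𝔻) : ∃ c : ℝ, ∀ f : H2, ‖f.toFun z‖ ≤ c * ‖f‖ := by
  obtain ⟨r, hzr, hr1⟩ := exists_between z.norm_lt_one
  let r' : Set.Ioo (0 : ℝ) 1 := ⟨r, (norm_nonneg _).trans_lt hzr, hr1⟩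
  have hnn : 0 ≤ r / (r - ‖(z : ℂ)‖) := div_nonneg r'.2.1.le (sub_nonneg.2 hzr.le)
  refine ⟨Real.sqrt (r / (r - ‖(z : ℂ)‖)), fun f => ?_⟩
  refine le_of_sq_le_sq ?_ (by positivity)
  rw [mul_pow, Real.sq_sqrt hnn]
  refine (f.isAnalytic.norm_sq_le r' hzr).trans ?_
  gcongr
  · exact quadMean_nonneg _ _
  · exact f.quadMean_le r'

/-- The evaluation at a point of the disc, as a bounded linear functional on `H^2`. -/
def H2.eval (z : 𝔻) : H2 →L[ℂ] ℂ :=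
  LinearMap.mkContinuousOfExistsBound ((LinearMap.proj z : (𝔻 → ℂ) →ₗ[ℂ] ℂ).comp H2.toFun)
    (H2.norm_toFun_le z)

/-- The constant function `1`, as an element of `H^2`. -/
def H2.one : H2 :=
  ⟨fun _ => 1, isAnalyticOnDisc_of (F := fun _ => 1) (differentiableOn_const 1), 1, by
    rintro _ ⟨r, rfl⟩
    exact quadMean_le_of_norm_le
      (isAnalyticOnDisc_of (F := fun _ => 1) (differentiableOn_const 1)) zero_le_one
      (fun _ => by simp) r⟩

theorem H2.one_toFun (z : 𝔻) : H2.one.toFun z = 1 := rfl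

/-- The value of an element of `H^∞` at a point of the disc. -/
def HInf.eval (z : 𝔻) : HInf →ₐ[ℂ] ℂ where
  toFun φ := (φ : BoundedContinuousFunction 𝔻 ℂ) z
  map_one' := rfl
  map_mul' _ _ := rfl
  map_zero' := rfl
  map_add' _ _ := rfl
  commutes' _ := rfl

theorem HInf.norm_eval_le (z : 𝔻) (φ : HInf) : ‖HInf.eval z φ‖ ≤ ‖φ‖ :=
  (φ : BoundedContinuousFunction 𝔻 ℂ).norm_coe_le_norm z

theorem HInf.isAnalytic (φ : HInf) : IsAnalyticOnDisc fun z => HInf.eval z φ := φ.2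

theorem HInf.quadMean_mul_le (φ : HInf) (f : H2) (r : Set.Ioo (0 : ℝ) 1) :
    quadMean ((fun z => HInf.eval z φ) * f.toFun) r ≤ ‖φ‖ * ‖f‖ :=
  (ShiftType.quadMean_mul_le (HInf.isAnalytic φ) f.isAnalytic (norm_nonneg φ)
    (fun z => HInf.norm_eval_le z φ) r).trans
    (mul_le_mul_of_nonneg_left (f.quadMean_le r) (norm_nonneg φ))

/-- The product of an element of `H^∞` and an element of `H^2`. -/
def HInf.mulFun (φ : HInf) (f : H2) : H2 :=
  ⟨(fun z => HInf.eval z φ) * f.toFun, (HInf.isAnalytic φ).mul f.isAnalytic, ‖φ‖ * ‖f‖, by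
    rintro _ ⟨r, rfl⟩
    exact HInf.quadMean_mul_le φ f r⟩

theorem HInf.mulFun_toFun (φ : HInf) (f : H2) (z : 𝔻) :
    (HInf.mulFun φ f).toFun z = HInf.eval z φ * f.toFun z := rfl

theorem H2.ext {f g : H2} (h : ∀ z, f.toFun z = g.toFun z) : f = g :=
  H2.toFun_injective (funext h)

/-- Multiplication by an element of `H^∞`, as a bounded operator on `H^2`. -/
def HInf.mulCLM (φ : HInf) : H2 →L[ℂ] H2 :=
  LinearMap.mkContinuous
    { toFun := HInf.mulFun φ
      map_add' := fun f g => H2.ext fun z => by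
        simp only [mulFun_toFun, map_add, Pi.add_apply, mul_add]
      map_smul' := fun c f => H2.ext fun z => by
        simp only [mulFun_toFun, map_smul, Pi.smul_apply, smul_eq_mul, RingHom.id_apply,
          mul_left_comm] }
    ‖φ‖ fun f => hardyNorm_le fun r => HInf.quadMean_mul_le φ f r

/-- The representation of `H^∞` by multiplication operators on `H^2`. -/
def HInf.mulOp : HInf →ₐ[ℂ] (H2 →L[ℂ] H2) :=
  AlgHom.ofLinearMap
    { toFun := HInf.mulCLM
      map_add' := fun φ ψ => ContinuousLinearMap.ext fun f => H2.ext fun z => by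
        change HInf.eval z (φ + ψ) * f.toFun z = HInf.eval z φ * f.toFun z + HInf.eval z ψ * _
        exact add_mul (HInf.eval z φ) (HInf.eval z ψ) _
      map_smul' := fun c φ => ContinuousLinearMap.ext fun f => H2.ext fun z => by
        change HInf.eval z (c • φ) * f.toFun z = c * (HInf.eval z φ * f.toFun z)
        exact mul_assoc c (HInf.eval z φ) _ }
    (ContinuousLinearMap.ext fun f => H2.ext fun z => by
      change HInf.eval z 1 * f.toFun z = f.toFun z
      rw [map_one, one_mul])
    (fun φ ψ => ContinuousLinearMap.ext fun f => H2.ext fun z => by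
      change HInf.eval z (φ * ψ) * f.toFun z = HInf.eval z φ * (HInf.eval z ψ * f.toFun z)
      rw [map_mul, mul_assoc])

theorem HInf.mulOp_toFun (φ : HInf) (f : H2) (z : 𝔻) :
    (mulOp φ f).toFun z = HInf.eval z φ * f.toFun z := rfl

theorem HInf.norm_mulOp_le (φ : HInf) : ‖mulOp φ‖ ≤ ‖φ‖ :=
  ContinuousLinearMap.opNorm_le_bound _ (norm_nonneg φ) fun f =>
    hardyNorm_le fun r => HInf.quadMean_mul_le φ f r

theorem HInf.mulOp_coord : mulOp coord = S := rfl

/-- The polynomial `q`, as an element of `H^∞`. -/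
def HInf.ofPoly (q : ℂ[X]) : HInf := aeval HInf.coord q

theorem HInf.eval_ofPoly (q : ℂ[X]) (z : 𝔻) : HInf.eval z (ofPoly q) = q.eval (z : ℂ) := by
  rw [ofPoly, ← aeval_algHom_apply, ← coe_aeval_eq_eval]
  rfl

theorem HInf.norm_ofPoly (q : ℂ[X]) : ‖ofPoly q‖ = ⨆ z : 𝔻, ‖q.eval (z : ℂ)‖ := by
  simp_rw [← eval_ofPoly]
  exact BoundedContinuousFunction.norm_eq_iSup_norm _

theorem HInf.mulOp_ofPoly (q : ℂ[X]) : mulOp (ofPoly q) = aeval S q := by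
  rw [ofPoly, ← aeval_algHom_apply, mulOp_coord]

theorem HInf.norm_le_of_eval {φ : HInf} {c : ℝ} (hc : 0 ≤ c) (h : ∀ z, ‖HInf.eval z φ‖ ≤ c) :
    ‖φ‖ ≤ c :=
  (BoundedContinuousFunction.norm_le hc).2 h

/-! ### Weak convergence in `H^2` and density of the polynomials -/

/-- Bounded sequences in `H^2` which converge at every point of the disc converge weakly. As
`H^2` carries no inner product, the Riesz representation of functionals is transferred from a
Hilbert space through the isomorphism `e`. The vectors representing the point evaluations
have dense span, since only the zero function is annihilated by all evaluations. -/
theorem H2.tendsto_dual_of_tendsto_eval {E : Type*} [NormedAddCommGroup E] [InnerProductSpace ℂ E]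
    [CompleteSpace E] (e : E ≃L[ℂ] H2) {u : ℕ → H2} {v : H2} {C : ℝ} (hC : ∀ j, ‖u j‖ ≤ C)
    (h : ∀ z, Tendsto (fun j => (u j).toFun z) atTop (𝓝 (v.toFun z))) (ℓ : H2 →L[ℂ] ℂ) :
    Tendsto (fun j => ℓ (u j)) atTop (𝓝 (ℓ v)) := by
  -- The vector `w z` represents the evaluation at `z`.
  let w : 𝔻 → E := fun z => (InnerProductSpace.toDual ℂ E).symm ((H2.eval z).comp (e : E →L[ℂ] H2))
  have hw : ∀ z x, inner ℂ (w z) x = (e x).toFun z := fun z x => by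
    simp only [w, InnerProductSpace.toDual_symm_apply]; rfl
  have hdense : (Submodule.span ℂ (Set.range w)).topologicalClosure = ⊤ := by
    rw [Submodule.topologicalClosure_eq_top_iff, Submodule.eq_bot_iff]
    intro x hx
    have hx0 : e x = 0 := H2.ext fun z => by
      rw [← hw, map_zero]
      exact hx _ (Submodule.subset_span ⟨z, rfl⟩)
    simpa using hx0
  let A : ℕ → E →L[ℂ] ℂ := fun j => innerSL ℂ (e.symm (u j - v))
  have hA : ∀ j, ‖A j‖ ≤ ‖(e.symm : H2 →L[ℂ] E)‖ * (C + ‖v‖) := fun j => by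
    rw [innerSL_apply_norm]
    refine ((e.symm : H2 →L[ℂ] E).le_opNorm _).trans ?_
    gcongr
    exact (norm_sub_le _ _).trans (by linarith [hC j])
  have key := tendsto_zero_of_dense_span (l := atTop) hA hdense (by
    rintro _ ⟨z, rfl⟩
    have h0 := (tendsto_sub_nhds_zero_iff.2 (h z)).star
    rw [star_zero] at h0
    refine h0.congr fun j => ?_
    rw [innerSL_apply_apply, ← inner_conj_symm, hw, ContinuousLinearEquiv.apply_symm_apply, map_sub]
    rfl)
  have h1 := (key ((InnerProductSpace.toDual ℂ E).symm (ℓ.comp (e : E →L[ℂ] H2)))).star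
  rw [star_zero] at h1
  refine tendsto_sub_nhds_zero_iff.1 (h1.congr fun j => ?_)
  have : inner ℂ ((InnerProductSpace.toDual ℂ E).symm (ℓ.comp (e : E →L[ℂ] H2)))
      (e.symm (u j - v)) = ℓ (u j - v) := by
    rw [InnerProductSpace.toDual_symm_apply]; simp
  rw [innerSL_apply_apply, ← map_sub, ← this, ← inner_conj_symm]
  exact star_star _

variable {E : Type*} [NormedAddCommGroup E] [InnerProductSpace ℂ E] [CompleteSpace E]

/-- The constant function `1` is cyclic for the shift, that is, the polynomials are dense in `H^2`.
-/
theorem H2.dense_span_S_pow_one (e : E ≃L[ℂ] H2) :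
    (Submodule.span ℂ (Set.range fun k : ℕ => (S ^ k) H2.one)).topologicalClosure = ⊤ := by
  refine Submodule.eq_top_iff'.2 fun f => ?_
  obtain ⟨r, q, hq, hqf⟩ := f.isAnalytic.exists_polynomial_tendsto
  refine mem_closure_of_forall_dual_tendsto (u := fun j => HInf.mulOp (HInf.ofPoly (q j)) H2.one)
    ((Submodule.span ℂ (Set.range fun k : ℕ => (S ^ k) H2.one)).restrictScalars ℝ).convex
    (fun j => ?_) (H2.tendsto_dual_of_tendsto_eval e (C := ‖f‖ + 1) (fun j => ?_) fun z => ?_)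
  · rw [HInf.mulOp_ofPoly, aeval_eq_sum_range, sum_apply]
    exact Submodule.sum_mem (Submodule.span ℂ _) fun k _ =>
      Submodule.smul_mem _ _ (Submodule.subset_span (Set.mem_range_self k))
  -- A polynomial within `1` of a dilation of `f` has norm at most `‖f‖ + 1`, as dilations do not
  -- increase the Hardy norm.
  · refine hardyNorm_le fun ρ => ?_
    have hu : (HInf.mulOp (HInf.ofPoly (q j)) H2.one).toFun =
        (fun z : 𝔻 => discExt f.toFun (r j * z)) +
          fun z : 𝔻 => (q j).eval (z : ℂ) - discExt f.toFun (r j * z) := by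
      funext z
      simp [HInf.mulOp_toFun, HInf.eval_ofPoly, H2.one_toFun]
    have hd : IsAnalyticOnDisc fun z : 𝔻 => (q j).eval (z : ℂ) - discExt f.toFun (r j * z) := by
      have h1 : IsAnalyticOnDisc fun z : 𝔻 => (q j).eval (z : ℂ) :=
        isAnalyticOnDisc_of (F := fun z => (q j).eval z) (q j).differentiable.differentiableOn
      convert h1.add ((f.isAnalytic.dilate (r j)).smul (-1)) using 1
      funext z
      simp [sub_eq_add_neg]
    rw [hu]
    refine (quadMean_add_le (f.isAnalytic.dilate (r j)) hd ρ).trans (add_le_add ?_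
      (quadMean_le_of_norm_le hd zero_le_one (hq j) ρ))
    rw [quadMean_dilate]
    exact f.quadMean_le ⟨r j * ρ, mul_pos (r j).2.1 ρ.2.1,
      mul_lt_one_of_nonneg_of_lt_one_left (r j).2.1.le (r j).2.2 ρ.2.2.le⟩
  · simpa [HInf.mulOp_toFun, HInf.eval_ofPoly, H2.one_toFun] using hqf z

theorem HInf.tendsto_dual_mulOp (e : E ≃L[ℂ] H2) {φ : ℕ → HInf} {ψ : HInf} {C : ℝ}
    (hC : ∀ j, ‖φ j‖ ≤ C)
    (h : ∀ z, Tendsto (fun j => HInf.eval z (φ j)) atTop (𝓝 (HInf.eval z ψ)))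
    (ℓ : H2 →L[ℂ] ℂ) (f : H2) :
    Tendsto (fun j => ℓ (mulOp (φ j) f)) atTop (𝓝 (ℓ (mulOp ψ f))) :=
  H2.tendsto_dual_of_tendsto_eval e (C := C * ‖f‖)
    (fun j => (mulOp (φ j)).le_of_opNorm_le ((norm_mulOp_le _).trans (hC j)) f)
    (fun z => (h z).mul_const _) ℓ

/-- Every multiplication operator is the strong limit of multiplications by polynomials, with
control of the uniform norms. -/
theorem HInf.exists_polynomial_tendsto_mulOp (e : E ≃L[ℂ] H2) (φ : HInf) :
    ∃ q : ℕ → ℂ[X], (∀ j, ‖ofPoly (q j)‖ ≤ ‖φ‖ + 1) ∧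
      ∀ f, Tendsto (fun j => mulOp (ofPoly (q j)) f) atTop (𝓝 (mulOp φ f)) := by
  -- The set `Q` of admissible polynomials is convex, so its weak limits in `H^2` are norm limits.
  let Q : Set H2 := {g | ∃ q : ℂ[X], ‖ofPoly q‖ ≤ ‖φ‖ + 1 ∧ mulOp (ofPoly q) H2.one = g}
  have hQ : Convex ℝ Q := by
    rintro _ ⟨p, hp, rfl⟩ _ ⟨q, hq, rfl⟩ a b ha hb hab
    have hpq : ofPoly ((a : ℂ) • p + (b : ℂ) • q) = (a : ℂ) • ofPoly p + (b : ℂ) • ofPoly q := by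
      simp only [ofPoly, map_add, map_smul]
    refine ⟨(a : ℂ) • p + (b : ℂ) • q, ?_, ?_⟩
    · rw [hpq]
      refine (norm_add_le _ _).trans ?_
      rw [norm_smul, norm_smul, Complex.norm_real, Complex.norm_real, Real.norm_of_nonneg ha,
        Real.norm_of_nonneg hb]
      calc a * ‖ofPoly p‖ + b * ‖ofPoly q‖ ≤ a * (‖φ‖ + 1) + b * (‖φ‖ + 1) := by gcongr
        _ = ‖φ‖ + 1 := by rw [← add_mul, hab, one_mul]
    · rw [hpq, map_add, map_smul, map_smul]
      rfl
  have hmem : mulOp φ H2.one ∈ closure Q := by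
    obtain ⟨r, q, hq, hqφ⟩ := (HInf.isAnalytic φ).exists_polynomial_tendsto
    have hle : ∀ j, ‖ofPoly (q j)‖ ≤ ‖φ‖ + 1 := fun j => by
      refine norm_le_of_eval (by positivity) fun z => ?_
      have hz : ‖((r j : ℝ) : ℂ) * z‖ < 1 := by
        rw [norm_mul, Complex.norm_real, Real.norm_of_nonneg (r j).2.1.le]
        exact mul_lt_one_of_nonneg_of_lt_one_left (r j).2.1.le (r j).2.2 z.norm_lt_one.le
      have h1 := hq j z
      rw [discExt_of_lt _ hz] at h1
      rw [eval_ofPoly]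
      linarith [norm_le_norm_add_norm_sub' ((q j).eval (z : ℂ)) (eval (.mk _ hz) φ),
        norm_eval_le (.mk _ hz) φ]
    exact mem_closure_of_forall_dual_tendsto hQ (fun j => ⟨q j, hle j, rfl⟩) fun ℓ =>
      tendsto_dual_mulOp e hle (fun z => by simpa only [eval_ofPoly] using hqφ z) ℓ _
  obtain ⟨g, hg, hgφ⟩ := mem_closure_iff_seq_limit.1 hmem
  choose q hq hqg using hg
  refine ⟨q, hq, tendsto_of_dense_span (K := ‖φ‖ + 1) (fun j => (norm_mulOp_le _).trans (hq j))
    (H2.dense_span_S_pow_one e) ?_⟩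
  -- On `S ^ k 1` the convergence follows from that on `1`, as multiplications commute with `S`.
  have hcomm : ∀ (ψ : HInf) (k : ℕ) (f : H2), mulOp ψ ((S ^ k) f) = (S ^ k) (mulOp ψ f) := by
    intro ψ k f
    rw [← mulOp_coord, ← map_pow, ← mul_apply_eq_comp, ← map_mul, mul_comm, map_mul,
      mul_apply_eq_comp]
  rintro _ ⟨k, rfl⟩
  simp only [hcomm, hqg]
  exact ((S ^ k).continuous.tendsto _).comp hgφ

/-! ### Operators intertwined with the shift -/

section Intertwining

variable {H : Type*} [NormedAddCommGroup H] [InnerProductSpace ℂ H] {T : H →L[ℂ] H}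

theorem pow_apply_of_intertwining {Y : H2 →L[ℂ] H} (hY : ∀ f, T (Y f) = Y (S f)) (k : ℕ) (f : H2) :
    (T ^ k) (Y f) = Y ((S ^ k) f) := by
  induction k generalizing f with
  | zero => rfl
  | succ k ih => rw [pow_succ, pow_succ, mul_apply_eq_comp,
      mul_apply_eq_comp, hY, ih]

theorem aeval_apply_of_intertwining {Y : H2 →L[ℂ] H} (hY : ∀ f, T (Y f) = Y (S f)) (q : ℂ[X])
    (f : H2) : aeval T q (Y f) = Y (HInf.mulOp (HInf.ofPoly q) f) := by
  rw [HInf.mulOp_ofPoly, aeval_eq_sum_range, aeval_eq_sum_range, sum_apply,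
    sum_apply, map_sum]
  refine Finset.sum_congr rfl fun k _ => ?_
  rw [smul_apply, smul_apply, map_smul,
    pow_apply_of_intertwining hY]

/-- The images of the constant function `1` under the intertwining maps form a cyclic family. -/
theorem cyclicSpan_of_intertwining (e : E ≃L[ℂ] H2) {ι : Type*} {Y : ι → H2 →L[ℂ] H}
    (hY : ∀ k f, T (Y k f) = Y k (S f))
    (hd : (Submodule.span ℂ (⋃ k, Set.range (Y k))).topologicalClosure = ⊤) :
    cyclicSpan T (fun k => Y k H2.one) = ⊤ := by
  rw [eq_top_iff, ← hd]
  refine Submodule.topologicalClosure_minimal _ (Submodule.span_le.2 ?_)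
    (Submodule.isClosed_topologicalClosure _)
  refine Set.iUnion_subset fun k => ?_
  rintro _ ⟨f, rfl⟩
  have hle : (Submodule.span ℂ (Set.range fun j : ℕ => (S ^ j) H2.one)).topologicalClosure ≤
      (cyclicSpan T fun k => Y k H2.one).comap (Y k : H2 →ₗ[ℂ] H) := by
    refine Submodule.topologicalClosure_minimal _ (Submodule.span_le.2 ?_)
      ((Submodule.isClosed_topologicalClosure _).preimage (Y k).continuous)
    rintro _ ⟨j, rfl⟩
    exact Submodule.le_topologicalClosure _
      (Submodule.subset_span ⟨(k, j), pow_apply_of_intertwining (hY k) j _⟩)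
  rw [H2.dense_span_S_pow_one e] at hle
  exact hle trivial

variable [CompleteSpace H]

/-- For `φ` in `H^∞` the operator `φ(T)`, constructed as a strong limit of polynomials in `T`. -/
theorem exists_clm_of_intertwining (e : E ≃L[ℂ] H2) (hT : IsPolynomiallyBounded T) {ι : Type*}
    {Y : ι → H2 →L[ℂ] H} (hY : ∀ k f, T (Y k f) = Y k (S f))
    (hd : (Submodule.span ℂ (⋃ k, Set.range (Y k))).topologicalClosure = ⊤) :
    ∃ K : ℝ, ∀ φ : HInf, ∃ A : H →L[ℂ] H, ‖A‖ ≤ K * (‖φ‖ + 1) ∧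
      ∀ k f, A (Y k f) = Y k (HInf.mulOp φ f) := by
  obtain ⟨C, hC⟩ := hT
  refine ⟨|C|, fun φ => ?_⟩
  obtain ⟨q, hq, hqφ⟩ := HInf.exists_polynomial_tendsto_mulOp e φ
  have hlim : ∀ k f, Tendsto (fun j => aeval T (q j) (Y k f)) atTop (𝓝 (Y k (HInf.mulOp φ f))) := by
    intro k f
    simp only [aeval_apply_of_intertwining (hY k)]
    exact ((Y k).continuous.tendsto _).comp (hqφ f)
  have hbound : ∀ j, ‖aeval T (q j)‖ ≤ |C| * (‖φ‖ + 1) := fun j => by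
    refine (hC (q j)).trans ?_
    rw [← HInf.norm_ofPoly]
    exact mul_le_mul (le_abs_self C) (hq j) (norm_nonneg _) (abs_nonneg C)
  obtain ⟨A, hA, hAq⟩ := exists_tendsto_of_dense_span hbound hd fun x hx => by
    obtain ⟨k, f, rfl⟩ := Set.mem_iUnion.1 hx
    exact ⟨_, hlim k f⟩
  exact ⟨A, hA, fun k f => tendsto_nhds_unique (hAq _) (hlim k f)⟩

/-- A polynomially bounded operator is absolutely continuous if the ranges of the bounded maps
intertwining it with the shift span a dense subspace. The relation `Φ(φ) Y = Y M_φ`, for every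
intertwining map `Y` of the family and the multiplication operator `M_φ`, determines `Φ(φ)`;
this makes `Φ` an algebra homomorphism, and reduces its continuity to that of `φ ↦ M_φ`. -/
theorem isAbsolutelyContinuous_of_intertwining (e : E ≃L[ℂ] H2) (hT : IsPolynomiallyBounded T)
    {ι : Type*} {Y : ι → H2 →L[ℂ] H} (hY : ∀ k f, T (Y k f) = Y k (S f))
    (hd : (Submodule.span ℂ (⋃ k, Set.range (Y k))).topologicalClosure = ⊤) :
    IsAbsolutelyContinuous T := by
  obtain ⟨K, hK⟩ := exists_clm_of_intertwining e hT hY hd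
  choose A hAn hA using hK
  have huniq : ∀ {B C : H →L[ℂ] H}, (∀ k f, B (Y k f) = C (Y k f)) → B = C := by
    intro B C h
    refine ContinuousLinearMap.ext_on (s := ⋃ k, Set.range (Y k)) ?_ ?_
    · rw [dense_iff_closure_eq, ← Submodule.topologicalClosure_coe, hd, Submodule.top_coe]
    · intro x hx
      obtain ⟨k, f, rfl⟩ := Set.mem_iUnion.1 hx
      exact h k f
  let Φ : HInf →ₐ[ℂ] (H →L[ℂ] H) := AlgHom.ofLinearMap
    { toFun := A
      map_add' := fun φ ψ => huniq fun k f => by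
        simp [hA]
      map_smul' := fun c φ => huniq fun k f => by
        simp [hA] }
    (huniq fun k f => by simp [hA])
    (fun φ ψ => huniq fun k f => by simp [hA])
  have hΦ : ∀ φ k f, Φ φ (Y k f) = Y k (HInf.mulOp φ f) := hA
  have hΦn : ∀ φ, ‖Φ φ‖ ≤ K * (‖φ‖ + 1) := hAn
  have hK0 : 0 ≤ K := by simpa using (norm_nonneg _).trans (hΦn 0)
  refine ⟨Φ, ?_, ?_, ?_⟩
  · obtain ⟨c, hc⟩ := LinearMap.bound_of_ball_bound one_pos (K * 2) Φ.toLinearMap fun φ hφ => by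
      rw [mem_ball_zero_iff] at hφ
      exact (hΦn φ).trans (mul_le_mul_of_nonneg_left (by linarith) hK0)
    exact AddMonoidHomClass.continuous_of_bound Φ.toLinearMap c hc
  · exact huniq fun k f => by rw [hΦ, HInf.mulOp_coord, hY]
  · rintro φ ψ ⟨C, hC⟩ hφ x y
    refine tendsto_of_dense_span (A := fun j => (innerSL ℂ y).comp (Φ (φ j)))
      (B := (innerSL ℂ y).comp (Φ ψ)) (K := ‖innerSL ℂ y‖ * (K * (C + 1))) (fun j => ?_) hd ?_ x
    · refine (ContinuousLinearMap.opNorm_comp_le _ _).trans ?_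
      gcongr
      refine (hΦn _).trans ?_
      gcongr
      exact hC j
    · intro x hx
      obtain ⟨k, f, rfl⟩ := Set.mem_iUnion.1 hx
      simp only [ContinuousLinearMap.comp_apply, hΦ]
      exact HInf.tendsto_dual_mulOp e hC hφ ((innerSL ℂ y).comp (Y k)) f

end Intertwining

end ShiftType

end

theorem mainTheorem11 {H : Type*} [NormedAddCommGroup H] [InnerProductSpace ℂ H] [CompleteSpace H]
    (n : ℕ) (hn : 1 ≤ n) (T : H →L[ℂ] H) (hT : ShiftType.IsPolynomiallyBounded T)
    (M : Fin n → Submodule ℂ H) (hM : ∀ k, M k ∈ ShiftType.Lat T)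
    (hS : ∀ k, ShiftType.Similar (ShiftType.restrictLat T (hM k)) ShiftType.S)
    (hspan : (⨆ k, M k).topologicalClosure = ⊤) :
    ShiftType.opMultiplicity T ≤ n ∧ ShiftType.IsAbsolutelyContinuous T := by
  choose X hX using hS
  let Y : Fin n → ShiftType.H2 →L[ℂ] H := fun k =>
    (M k).subtypeL.comp ((X k).symm : ShiftType.H2 →L[ℂ] M k)
  have hY : ∀ k f, T (Y k f) = Y k (ShiftType.S f) := by
    intro k f
    have h := hX k ((X k).symm f)
    rw [ContinuousLinearEquiv.apply_symm_apply, ← ContinuousLinearEquiv.eq_symm_apply] at h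
    exact congrArg Subtype.val h
  have hd : (Submodule.span ℂ (⋃ k, Set.range (Y k))).topologicalClosure = ⊤ := by
    have hr : ∀ k, Set.range (Y k) = M k := by
      intro k
      ext x
      constructor
      · rintro ⟨f, rfl⟩
        exact ((X k).symm f).2
      · intro hx
        exact ⟨X k ⟨x, hx⟩, by simp [Y]⟩
    simp only [hr, Submodule.span_iUnion, Submodule.span_eq]
    exact hspan
  -- Any one of the closed subspaces `M k` is a Hilbert space isomorphic to `H^2`.
  let k₀ : Fin n := ⟨0, hn⟩
  have : CompleteSpace (M k₀) := (hM k₀).1.completeSpace_coe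
  exact ⟨sInf_le ⟨n, rfl, hn, _, ShiftType.cyclicSpan_of_intertwining (X k₀) hY hd⟩,
    ShiftType.isAbsolutelyContinuous_of_intertwining (X k₀) hT hY hd⟩
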